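/- Let $d\ge 1$, and let $T_3$ denote the infinite 3-regular tree. A random copy of $T_3$ in $\mathbb{R}^d$ is a random graph $T$ whose vertex set $V(T)$ is a random set of points (a point process, not assumed to be locally finite) in $\mathbb{R}^d$, such that $T$ is almost surely isomorphic to $T_3$; it is $\mathrm{Isom}(\mathbb{R}^d)$-invariant if for every isometry $\varphi$ of $\mathbb{R}^d$ the image graph $\varphi(T)$ has the same distribution as $T$ (measurability and distributions being understood with respect to the $\sigma$-algebra generated by the numbers of vertices in Borel subsets of $\mathbb{R}^d$ and the numbers of ordered pairs of adjacent vertices in Borel subsets of $\mathbb{R}^d\times\mathbb{R}^d$). If $T$ is an $\mathrm{Isom}(\mathbb{R}^d)$-invariant random copy of $T_3$ in $\mathbb{R}^d$, then $V(T)$ has infinite intensity, that is, $$\mathbb{E}\,\bigl|V(T)\cap[0,1]^d\bigr|=\infty .$$ -/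

import Mathlib

open MeasureTheory
open scoped ENNReal

/-- Euclidean space `ℝ^d`, with the Euclidean metric. -/
abbrev Euc (d : ℕ) : Type := EuclideanSpace ℝ (Fin d)

/-- A simple graph drawn on a set of points of `ℝ^d`: a set `G.verts ⊆ ℝ^d` of vertices together
with a symmetric, irreflexive adjacency relation `G.Adj` between elements of `G.verts`. -/
abbrev SpatialGraph (d : ℕ) : Type := (⊤ : SimpleGraph (Euc d)).Subgraph

namespace SpatialGraph

variable {d : ℕ}

/-- The number of vertices of `G` in the set `B`. -/
noncomputable def vertexCount (B : Set (Euc d)) (G : SpatialGraph d) : ℝ≥0∞ :=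
  ((G.verts ∩ B).encard : ℝ≥0∞)

/-- The number of ordered pairs `(x, y) ∈ C` of adjacent vertices of `G`. -/
noncomputable def edgeCount (C : Set (Euc d × Euc d)) (G : SpatialGraph d) : ℝ≥0∞ :=
  (({p : Euc d × Euc d | G.Adj p.1 p.2} ∩ C).encard : ℝ≥0∞)

/-- The usual σ-algebra of point process theory, for the vertices and the edges: it is generated
by the numbers of vertices in Borel sets of `ℝ^d` and of (ordered) edges in Borel sets of
`ℝ^d × ℝ^d`. -/
noncomputable instance : MeasurableSpace (SpatialGraph d) :=
  (⨆ (B : Set (Euc d)) (_ : MeasurableSet B),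
      MeasurableSpace.comap (vertexCount B) inferInstance) ⊔
  (⨆ (C : Set (Euc d × Euc d)) (_ : MeasurableSet C),
      MeasurableSpace.comap (edgeCount C) inferInstance)

/-- The image of a spatial graph under an isometry `e` of `ℝ^d`: the vertices are the points
`e x`, with `x` a vertex of `G`, and `e x`, `e y` are adjacent when `x`, `y` are. -/
def move (e : Euc d ≃ᵢ Euc d) (G : SpatialGraph d) : SpatialGraph d :=
  G.map (SimpleGraph.Iso.completeGraph e.toEquiv).toHom

theorem measurable_vertexCount {B : Set (Euc d)} (hB : MeasurableSet B) :
    Measurable (vertexCount B) :=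
  Measurable.of_comap_le (le_sup_of_le_left (le_iSup₂_of_le B hB le_rfl))

theorem measurable_edgeCount {C : Set (Euc d × Euc d)} (hC : MeasurableSet C) :
    Measurable (edgeCount C) :=
  Measurable.of_comap_le (le_sup_of_le_right (le_iSup₂_of_le C hC le_rfl))

theorem verts_move (e : Euc d ≃ᵢ Euc d) (G : SpatialGraph d) :
    (move e G).verts = e '' G.verts := rfl

theorem adj_move (e : Euc d ≃ᵢ Euc d) (G : SpatialGraph d) (x y : Euc d) :
    (move e G).Adj (e x) (e y) ↔ G.Adj x y := by
  constructor
  · rintro ⟨a, b, h, ha, hb⟩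
    have ha' : a = x := e.injective ha
    have hb' : b = y := e.injective hb
    rwa [ha', hb'] at h
  · intro h
    exact ⟨x, y, h, rfl, rfl⟩

theorem vertexCount_move (e : Euc d ≃ᵢ Euc d) (B : Set (Euc d)) (G : SpatialGraph d) :
    vertexCount B (move e G) = vertexCount (e ⁻¹' B) G := by
  unfold vertexCount
  rw [verts_move, ← Set.image_inter_preimage, e.injective.encard_image]

theorem edgeCount_move (e : Euc d ≃ᵢ Euc d) (C : Set (Euc d × Euc d)) (G : SpatialGraph d) :
    edgeCount C (move e G) = edgeCount (Prod.map e e ⁻¹' C) G := by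
  unfold edgeCount
  have h : {p : Euc d × Euc d | (move e G).Adj p.1 p.2} =
      Prod.map e e '' {p : Euc d × Euc d | G.Adj p.1 p.2} := by
    ext ⟨x, y⟩
    obtain ⟨x, rfl⟩ := e.surjective x
    obtain ⟨y, rfl⟩ := e.surjective y
    simp [adj_move]
  rw [h, ← Set.image_inter_preimage, (e.injective.prodMap e.injective).encard_image]

/-- Moving by an isometry is measurable, so the law of a moved random graph is meaningful. -/
theorem measurable_move (e : Euc d ≃ᵢ Euc d) : Measurable (move e) := by
  have hv : ∀ B : Set (Euc d), MeasurableSet B → Measurable (vertexCount B ∘ move e) := by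
    intro B hB
    have : vertexCount B ∘ move e = vertexCount (e ⁻¹' B) := by
      funext G
      exact vertexCount_move e B G
    rw [this]
    exact measurable_vertexCount (e.continuous.measurable hB)
  have he : ∀ C : Set (Euc d × Euc d), MeasurableSet C → Measurable (edgeCount C ∘ move e) := by
    intro C hC
    have : edgeCount C ∘ move e = edgeCount (Prod.map e e ⁻¹' C) := by
      funext G
      exact edgeCount_move e C G
    rw [this]
    exact measurable_edgeCount ((e.continuous.measurable.prodMap e.continuous.measurable) hC)
  rw [measurable_iff_comap_le]
  refine (MeasurableSpace.comap_sup ..).le.trans (sup_le ?_ ?_)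
  · simp only [MeasurableSpace.comap_iSup, MeasurableSpace.comap_comp]
    exact iSup₂_le fun B hB => (hv B hB).comap_le
  · simp only [MeasurableSpace.comap_iSup, MeasurableSpace.comap_comp]
    exact iSup₂_le fun C hC => (he C hC).comap_le

end SpatialGraph

/-- `H` is isomorphic to the infinite 3-regular tree `T₃`, i.e. `H` is a tree (nonempty, connected
and without cycles) in which every vertex has exactly three neighbours. Such a graph is
automatically infinite, and any two such graphs are isomorphic. -/
def IsT3 {V : Type*} (H : SimpleGraph V) : Prop :=
  H.IsTree ∧ ∀ v : V, (H.neighborSet v).encard = 3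

/-- An `Isom(ℝ^d)`-invariant random copy of `T₃` in `ℝ^d`: a random spatial graph, defined on the
probability space `(Ω, P)`, that is almost surely isomorphic to `T₃` and whose distribution is
invariant under all isometries of `ℝ^d` (reflections included). -/
structure IsInvariantRandomT3 {Ω : Type*} [MeasurableSpace Ω] (P : Measure Ω) {d : ℕ}
    (T : Ω → SpatialGraph d) : Prop where
  measurable : Measurable T
  isT3 : ∀ᵐ ω ∂P, IsT3 (T ω).coe
  invariant : ∀ e : Euc d ≃ᵢ Euc d, P.map (fun ω => SpatialGraph.move e (T ω)) = P.map T

/-- The unit cube `[0, 1]^d`. -/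
def unitCube (d : ℕ) : Set (Euc d) := {x | ∀ i, x i ∈ Set.Icc (0 : ℝ) 1}

/-- The intensity of the vertex set of a random spatial graph: the expected number of vertices in
the unit cube. -/
noncomputable def vertexIntensity {Ω : Type*} [MeasurableSpace Ω] (P : Measure Ω) {d : ℕ}
    (T : Ω → SpatialGraph d) : ℝ≥0∞ :=
  ∫⁻ ω, SpatialGraph.vertexCount (unitCube d) (T ω) ∂P

/-! Let `λ` be the mean number of vertices in a half-open unit lattice cube and `w k` the mean
number of ordered edges from cube `0` to cube `k`. Every degree is 3, so `w` sums to `3λ`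
(`tsum_lintegral_edgeCount`). The edges inside a finite union of cubes `F` form a forest, which has
average degree at most 2; by invariance `w (k - j)`, summed over `j, k ∈ F`, is at most `2λ|F|`
(`sum_lintegral_edgeCount_le`). Large boxes have negligible boundary, so `w` sums to at most `2λ`
(`tsum_le_of_sum_sub_le_card_mul`). Thus `3λ ≤ 2λ`, and since `λ ≠ 0`, `λ = ∞`. Only lattice
translations are used. -/

namespace SimpleGraph

/-- A forest extends to a spanning tree of the complete graph, which has `|V| - 1` edges, each
giving two ordered pairs. -/
theorem IsAcyclic.encard_adj_le {V : Type*} [Finite V] {G : SimpleGraph V} (hG : G.IsAcyclic) :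
    {p : V × V | G.Adj p.1 p.2}.encard ≤ 2 * ENat.card V := by
  classical
  have := Fintype.ofFinite V
  rcases isEmpty_or_nonempty V with hV | hV
  · simp [Set.eq_empty_of_isEmpty]
  obtain ⟨F, hGF, -, hF⟩ :=
    (connected_top (V := V)).exists_isTree_le_of_le_of_isAcyclic le_top hG
  have hsub : {p : V × V | G.Adj p.1 p.2} ⊆ Set.range (fun e : F.Dart => e.toProd) :=
    fun p hp => ⟨⟨p, hGF hp⟩, rfl⟩
  refine (Set.encard_le_encard hsub).trans ?_
  rw [← Set.image_univ]
  refine (Set.encard_image_le _ _).trans ?_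
  rw [Set.encard_univ, ENat.card_eq_coe_fintype_card, ENat.card_eq_coe_fintype_card,
    F.dart_card_eq_twice_card_edges, ← hF.card_edgeFinset]
  norm_cast
  omega

end SimpleGraph

theorem Set.toENNReal_encard_eq_tsum_fiber {α β : Type*} (f : α → β) (s : Set α) :
    (s.encard : ℝ≥0∞) = ∑' b, ((s ∩ f ⁻¹' {b}).encard : ℝ≥0∞) := by
  classical
  have h (t : Set α) : (t.encard : ℝ≥0∞) = ∑' a, t.indicator 1 a := by
    rw [← ENNReal.tsum_set_one, ← tsum_subtype]
    rfl
  simp_rw [h]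
  rw [ENNReal.tsum_comm]
  refine tsum_congr fun a => ?_
  rw [tsum_eq_single (f a)]
  · by_cases ha : a ∈ s <;> simp [ha]
  · intro b hb
    simp [hb.symm]

/-! ### Edge counts against vertex counts: forests and regular graphs. -/

namespace SpatialGraph

variable {d : ℕ}

theorem edgeCount_prod_self_le {G : SpatialGraph d} (hG : G.coe.IsAcyclic) (A : Set (Euc d)) :
    edgeCount (A ×ˢ A) G ≤ 2 * vertexCount A G := by
  unfold edgeCount vertexCount
  rcases (G.verts ∩ A).finite_or_infinite with hfin | hinf
  swap
  -- Local finiteness is not assumed; with infinitely many vertices in `A` the bound is `∞`.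
  · simp [hinf.encard_eq]
  have := hfin.to_subtype
  let f : ↥(G.verts ∩ A) ↪ G.verts := ⟨fun x => ⟨x.1, x.2.1⟩, fun x y h => by
    simpa [Subtype.ext_iff] using h⟩
  have hH := (hG.of_comap f).encard_adj_le
  have heq : {p : Euc d × Euc d | G.Adj p.1 p.2} ∩ A ×ˢ A ⊆
      Prod.map Subtype.val Subtype.val ''
        {p : ↥(G.verts ∩ A) × ↥(G.verts ∩ A) | (G.coe.comap f).Adj p.1 p.2} := by
    rintro ⟨x, y⟩ ⟨h, hx, hy⟩
    exact ⟨⟨⟨x, G.edge_vert h, hx⟩, ⟨y, G.edge_vert h.symm, hy⟩⟩, h, rfl⟩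
  have h2 := (Set.encard_le_encard heq).trans ((Set.encard_image_le _ _).trans hH)
  rw [ENat.card_coe_set_eq] at h2
  exact_mod_cast h2

theorem edgeCount_prod_univ {G : SpatialGraph d} {n : ℕ∞}
    (hG : ∀ v, (G.coe.neighborSet v).encard = n) (A : Set (Euc d)) :
    edgeCount (A ×ˢ Set.univ) G = n * vertexCount A G := by
  classical
  unfold edgeCount vertexCount
  rw [Set.toENNReal_encard_eq_tsum_fiber Prod.fst, ← ENNReal.tsum_set_one,
    tsum_subtype (G.verts ∩ A) (fun _ => (1 : ℝ≥0∞)), ← ENNReal.tsum_mul_left]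
  refine tsum_congr fun v => ?_
  by_cases hv : v ∈ G.verts ∩ A
  · rw [Set.indicator_of_mem hv, mul_one, ← hG ⟨v, hv.1⟩]
    have : {p : Euc d × Euc d | G.Adj p.1 p.2} ∩ A ×ˢ Set.univ ∩ Prod.fst ⁻¹' {v} =
        (fun w : G.verts => (v, (w : Euc d))) '' G.coe.neighborSet ⟨v, hv.1⟩ := by
      ext ⟨x, y⟩
      constructor
      · rintro ⟨⟨h, -⟩, rfl⟩
        exact ⟨⟨y, G.edge_vert h.symm⟩, h, rfl⟩
      · rintro ⟨w, h, hw⟩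
        obtain ⟨rfl, rfl⟩ := Prod.mk.inj hw
        exact ⟨⟨h, hv.2, trivial⟩, rfl⟩
    rw [this, Function.Injective.encard_image]
    intro a b hab
    exact Subtype.ext (Prod.mk.inj hab).2
  · rw [Set.indicator_of_notMem hv, mul_zero]
    have : {p : Euc d × Euc d | G.Adj p.1 p.2} ∩ A ×ˢ Set.univ ∩ Prod.fst ⁻¹' {v} = ∅ := by
      ext ⟨x, y⟩
      simp only [Set.mem_empty_iff_false, iff_false]
      rintro ⟨⟨h, hA⟩, rfl⟩
      exact hv ⟨G.edge_vert h, hA.1⟩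
    simp [this]

end SpatialGraph

/-! ### The partition of space into lattice cubes. -/

/-- The index of the half-open unit lattice cube that contains `x`. -/
noncomputable def latticeIndex {d : ℕ} (x : Euc d) : Fin d → ℤ := fun i => ⌊x i⌋

/-- The half-open unit lattice cube with lowest corner `k`. -/
def latticeCube {d : ℕ} (k : Fin d → ℤ) : Set (Euc d) := latticeIndex ⁻¹' {k}

/-- The translation of `ℝ^d` by the lattice vector `k`. -/
noncomputable def latticeShift {d : ℕ} (k : Fin d → ℤ) : Euc d ≃ᵢ Euc d :=
  IsometryEquiv.addRight (WithLp.toLp 2 fun i => (k i : ℝ))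

theorem latticeIndex_latticeShift {d : ℕ} (k : Fin d → ℤ) (x : Euc d) :
    latticeIndex (latticeShift k x) = latticeIndex x + k := by
  ext i
  simp [latticeIndex, latticeShift]

theorem preimage_latticeShift_latticeCube {d : ℕ} (j k : Fin d → ℤ) :
    latticeShift j ⁻¹' latticeCube k = latticeCube (k - j) := by
  ext x
  simp [latticeCube, latticeIndex_latticeShift, eq_sub_iff_add_eq]

theorem measurable_latticeIndex {d : ℕ} : Measurable (latticeIndex (d := d)) :=
  measurable_pi_lambda _ fun i => Int.measurable_floor.comp (by fun_prop)

theorem measurableSet_latticeCube {d : ℕ} (k : Fin d → ℤ) : MeasurableSet (latticeCube k) :=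
  measurable_latticeIndex (measurableSet_singleton k)

theorem latticeCube_zero_subset {d : ℕ} : latticeCube (0 : Fin d → ℤ) ⊆ unitCube d := by
  intro x hx i
  have h : ⌊x i⌋ = 0 := congrFun hx i
  rw [Int.floor_eq_zero_iff] at h
  exact ⟨h.1, h.2.le⟩

namespace SpatialGraph

variable {d : ℕ}

theorem edgeCount_prod_univ_eq_tsum (A : Set (Euc d)) (G : SpatialGraph d) :
    edgeCount (A ×ˢ Set.univ) G = ∑' k, edgeCount (A ×ˢ latticeCube k) G := by
  unfold edgeCount
  rw [Set.toENNReal_encard_eq_tsum_fiber (fun p : Euc d × Euc d => latticeIndex p.2)]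
  refine tsum_congr fun k => ?_
  congr 2
  ext p
  simp [latticeCube, and_assoc]

theorem vertexCount_univ_eq_tsum (G : SpatialGraph d) :
    vertexCount Set.univ G = ∑' k, vertexCount (latticeCube k) G := by
  unfold vertexCount
  rw [Set.toENNReal_encard_eq_tsum_fiber latticeIndex]
  simp [latticeCube]

theorem vertexCount_preimage_latticeIndex (F : Finset (Fin d → ℤ)) (G : SpatialGraph d) :
    vertexCount (latticeIndex ⁻¹' F) G = ∑ k ∈ F, vertexCount (latticeCube k) G := by
  unfold vertexCount
  rw [Set.toENNReal_encard_eq_tsum_fiber latticeIndex, tsum_eq_sum (s := F)]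
  · refine Finset.sum_congr rfl fun k hk => ?_
    congr 2
    ext x
    simp only [latticeCube, Set.mem_inter_iff, Set.mem_preimage, Set.mem_singleton_iff,
      Finset.mem_coe]
    grind
  · intro k hk
    rw [Set.eq_empty_of_forall_notMem (s := G.verts ∩ _ ∩ _)]
    · simp
    · rintro x ⟨⟨-, hx⟩, rfl⟩
      exact hk hx

theorem sum_edgeCount_latticeCube_le (F : Finset (Fin d → ℤ)) (G : SpatialGraph d) :
    ∑ p ∈ F ×ˢ F, edgeCount (latticeCube p.1 ×ˢ latticeCube p.2) G ≤
      edgeCount ((latticeIndex ⁻¹' F) ×ˢ (latticeIndex ⁻¹' F)) G := by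
  unfold edgeCount
  rw [Set.toENNReal_encard_eq_tsum_fiber (Prod.map latticeIndex latticeIndex)
    ({p : Euc d × Euc d | G.Adj p.1 p.2} ∩ (latticeIndex ⁻¹' F) ×ˢ (latticeIndex ⁻¹' F))]
  refine le_trans (Finset.sum_le_sum fun p hp => ?_) (ENNReal.sum_le_tsum (F ×ˢ F))
  rw [Finset.mem_product] at hp
  refine ENat.toENNReal_mono (Set.encard_le_encard ?_)
  rintro ⟨x, y⟩ ⟨h, hx, hy⟩
  have hx' : latticeIndex x = p.1 := hx
  have hy' : latticeIndex y = p.2 := hy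
  refine ⟨⟨h, ?_, ?_⟩, Prod.ext hx' hy'⟩
  · simpa [hx'] using hp.1
  · simpa [hy'] using hp.2

end SpatialGraph

/-! ### Averaging over large boxes of the lattice. -/

open Filter Topology in
/-- An averaged form of the amenability of `ℤ^d`. -/
theorem tsum_le_of_sum_sub_le_card_mul {d : ℕ} (w : (Fin d → ℤ) → ℝ≥0∞) (c : ℝ≥0∞)
    (h : ∀ F : Finset (Fin d → ℤ), ∑ p ∈ F ×ˢ F, w (p.2 - p.1) ≤ F.card * c) :
    ∑' k, w k ≤ c := by
  classical
  rw [ENNReal.tsum_eq_iSup_sum]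
  refine iSup_le fun S => ?_
  obtain ⟨M, hM⟩ : ∃ M : ℕ, ∀ s ∈ S, ∀ i, |s i| ≤ M := by
    refine ⟨∑ s ∈ S, ∑ i, (s i).natAbs, fun s hs i => ?_⟩
    rw [Int.abs_eq_natAbs]
    exact_mod_cast (Finset.single_le_sum (f := fun i => (s i).natAbs) (fun _ _ => Nat.zero_le _)
      (Finset.mem_univ i)).trans (Finset.single_le_sum (f := fun s => ∑ i, (s i).natAbs)
        (fun _ _ => Nat.zero_le _) hs)
  -- `F'` is the box `F` with a margin of width `M` removed. From each of its `n ^ d` points, every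
  -- step `s ∈ S` stays in `F`, so each `w s` occurs at least `n ^ d` times in the double sum.
  have key (n : ℕ) : (n : ℝ≥0∞) ^ d * ∑ s ∈ S, w s ≤ ((n + 2 * M : ℕ) : ℝ≥0∞) ^ d * c := by
    let F : Finset (Fin d → ℤ) := Fintype.piFinset fun _ => Finset.Ico 0 ((n + 2 * M : ℕ) : ℤ)
    let F' : Finset (Fin d → ℤ) := Fintype.piFinset fun _ => Finset.Ico (M : ℤ) (n + M : ℕ)
    have hF : F.card = (n + 2 * M) ^ d := by
      simp only [F, Fintype.card_piFinset_const, Int.card_Ico, sub_zero,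
        Int.toNat_natCast]
    have hF' : F'.card = n ^ d := by simp [F']
    have hle : ∑ q ∈ F' ×ˢ S, w q.2 ≤ ∑ p ∈ F ×ˢ F, w (p.2 - p.1) := by
      have hinj : Set.InjOn (fun q : (Fin d → ℤ) × (Fin d → ℤ) => (q.1, q.1 + q.2))
          (F' ×ˢ S : Finset _) := by
        rintro ⟨a, b⟩ - ⟨a', b'⟩ - hab
        simp only [Prod.mk.injEq] at hab
        obtain ⟨rfl, hb⟩ := hab
        simpa using hb
      calc ∑ q ∈ F' ×ˢ S, w q.2
          = ∑ p ∈ (F' ×ˢ S).image fun q => (q.1, q.1 + q.2), w (p.2 - p.1) := by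
            rw [Finset.sum_image hinj]
            simp
        _ ≤ _ := by
            refine Finset.sum_le_sum_of_subset ?_
            intro p hp
            obtain ⟨⟨a, s⟩, hq, rfl⟩ := Finset.mem_image.1 hp
            simp only [Finset.mem_product, F, F', Fintype.mem_piFinset, Finset.mem_Ico] at hq ⊢
            refine ⟨fun i => ?_, fun i => ?_⟩
            · have := hq.1 i
              push_cast at this ⊢
              omega
            · have := hq.1 i
              have hs := abs_le.1 (hM s hq.2 i)
              rw [Pi.add_apply]
              push_cast at this ⊢
              omega
    rw [Finset.sum_product] at hle
    simp only [Finset.sum_const, nsmul_eq_mul, hF'] at hle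
    have := hle.trans (h F)
    rw [hF] at this
    exact_mod_cast this
  have hlim : Tendsto (fun n : ℕ => ((n + 2 * M : ℕ) / n : ℝ≥0∞) ^ d * c) atTop (𝓝 c) := by
    have h1 : Tendsto (fun n : ℕ => ((n + 2 * M : ℕ) / n : ℝ≥0∞)) atTop (𝓝 1) := by
      have h2 : Tendsto (fun n : ℕ => 1 + ((2 * M : ℕ) : ℝ≥0∞) / n) atTop (𝓝 (1 + 0)) :=
        tendsto_const_nhds.add (by
          simpa [div_eq_mul_inv] using ENNReal.Tendsto.const_mul (a := ((2 * M : ℕ) : ℝ≥0∞))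
            ENNReal.tendsto_inv_nat_nhds_zero (Or.inr (ENNReal.natCast_ne_top _)))
      rw [add_zero] at h2
      refine h2.congr' ?_
      filter_upwards [eventually_gt_atTop 0] with n hn
      rw [Nat.cast_add n, ENNReal.add_div, ENNReal.div_self (by simp; omega) (by simp)]
    -- The limit of the ratio is nonzero, so `c = ∞` is allowed.
    have h3 := ENNReal.Tendsto.mul_const (b := c) (((ENNReal.continuous_pow d).tendsto 1).comp h1)
      (Or.inl (by simp))
    simpa using h3
  refine ge_of_tendsto hlim ?_
  filter_upwards [eventually_gt_atTop 0] with n hn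
  have hn0 : ((n : ℝ≥0∞) ^ d) ≠ 0 := pow_ne_zero _ (by simp; omega)
  have hnt : ((n : ℝ≥0∞) ^ d) ≠ ∞ := ENNReal.pow_ne_top (by simp)
  have := key n
  rw [div_eq_mul_inv, mul_pow, ← ENNReal.inv_pow, mul_right_comm, ← div_eq_mul_inv,
    ENNReal.le_div_iff_mul_le (Or.inl hn0) (Or.inl hnt), mul_comm]
  exact this

/-! ### Expected counts under invariance. -/

namespace IsInvariantRandomT3

open SpatialGraph

variable {Ω : Type*} [MeasurableSpace Ω] {P : Measure Ω} {d : ℕ} {T : Ω → SpatialGraph d}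

theorem lintegral_move (hT : IsInvariantRandomT3 P T) (e : Euc d ≃ᵢ Euc d)
    {f : SpatialGraph d → ℝ≥0∞} (hf : Measurable f) :
    ∫⁻ ω, f (move e (T ω)) ∂P = ∫⁻ ω, f (T ω) ∂P := by
  have h := lintegral_map (μ := P) hf ((measurable_move e).comp hT.measurable)
  have hinv : P.map (move e ∘ T) = P.map T := hT.invariant e
  rw [hinv, lintegral_map hf hT.measurable] at h
  exact h.symm

theorem lintegral_vertexCount_latticeCube (hT : IsInvariantRandomT3 P T) (k : Fin d → ℤ) :
    ∫⁻ ω, vertexCount (latticeCube k) (T ω) ∂P =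
      ∫⁻ ω, vertexCount (latticeCube 0) (T ω) ∂P := by
  rw [← hT.lintegral_move (latticeShift k)
    (measurable_vertexCount (measurableSet_latticeCube k))]
  simp only [vertexCount_move, preimage_latticeShift_latticeCube, sub_self]

theorem lintegral_edgeCount_latticeCube (hT : IsInvariantRandomT3 P T) (j k : Fin d → ℤ) :
    ∫⁻ ω, edgeCount (latticeCube j ×ˢ latticeCube k) (T ω) ∂P =
      ∫⁻ ω, edgeCount (latticeCube 0 ×ˢ latticeCube (k - j)) (T ω) ∂P := by
  rw [← hT.lintegral_move (latticeShift j)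
    (measurable_edgeCount ((measurableSet_latticeCube j).prod (measurableSet_latticeCube k)))]
  simp only [edgeCount_move, Set.preimage_prod_map_prod, preimage_latticeShift_latticeCube,
    sub_self]

theorem measurable_vertexCount_comp (hT : IsInvariantRandomT3 P T) (k : Fin d → ℤ) :
    Measurable fun ω => vertexCount (latticeCube k) (T ω) :=
  (measurable_vertexCount (measurableSet_latticeCube k)).comp hT.measurable

theorem measurable_edgeCount_comp (hT : IsInvariantRandomT3 P T) (j k : Fin d → ℤ) :
    Measurable fun ω => edgeCount (latticeCube j ×ˢ latticeCube k) (T ω) :=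
  (measurable_edgeCount ((measurableSet_latticeCube j).prod
    (measurableSet_latticeCube k))).comp hT.measurable

theorem tsum_lintegral_edgeCount (hT : IsInvariantRandomT3 P T) :
    ∑' k, ∫⁻ ω, edgeCount (latticeCube 0 ×ˢ latticeCube k) (T ω) ∂P =
      3 * ∫⁻ ω, vertexCount (latticeCube 0) (T ω) ∂P := by
  rw [← lintegral_tsum fun k => (hT.measurable_edgeCount_comp 0 k).aemeasurable,
    ← lintegral_const_mul _ (hT.measurable_vertexCount_comp 0)]
  refine lintegral_congr_ae ?_
  filter_upwards [hT.isT3] with ω hω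
  rw [← edgeCount_prod_univ_eq_tsum, edgeCount_prod_univ hω.2 (latticeCube 0)]
  rfl

theorem sum_lintegral_edgeCount_le (hT : IsInvariantRandomT3 P T) (F : Finset (Fin d → ℤ)) :
    ∑ p ∈ F ×ˢ F, ∫⁻ ω, edgeCount (latticeCube 0 ×ˢ latticeCube (p.2 - p.1)) (T ω) ∂P ≤
      F.card * (2 * ∫⁻ ω, vertexCount (latticeCube 0) (T ω) ∂P) := by
  simp_rw [← hT.lintegral_edgeCount_latticeCube]
  rw [← lintegral_finsetSum _ fun p _ => hT.measurable_edgeCount_comp p.1 p.2]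
  calc _ ≤ ∫⁻ ω, 2 * ∑ k ∈ F, vertexCount (latticeCube k) (T ω) ∂P := by
        refine lintegral_mono_ae ?_
        filter_upwards [hT.isT3] with ω hω
        rw [← vertexCount_preimage_latticeIndex]
        exact (sum_edgeCount_latticeCube_le F (T ω)).trans
          (edgeCount_prod_self_le hω.1.isAcyclic _)
    _ = _ := by
        rw [lintegral_const_mul _
            (Finset.measurable_fun_sum _ fun k _ => hT.measurable_vertexCount_comp k),
          lintegral_finsetSum _ fun k _ => hT.measurable_vertexCount_comp k]
        simp_rw [hT.lintegral_vertexCount_latticeCube]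
        rw [Finset.sum_const, nsmul_eq_mul, mul_left_comm]

/-- Countably many cubes cover space and share the same mean, so mean zero would make the tree
almost surely empty. -/
theorem lintegral_vertexCount_latticeCube_ne_zero [IsProbabilityMeasure P]
    (hT : IsInvariantRandomT3 P T) :
    ∫⁻ ω, vertexCount (latticeCube 0) (T ω) ∂P ≠ 0 := by
  intro h0
  have h1 : ∫⁻ ω, vertexCount Set.univ (T ω) ∂P = 0 := by
    simp_rw [vertexCount_univ_eq_tsum]
    rw [lintegral_tsum fun k => (hT.measurable_vertexCount_comp k).aemeasurable]
    simp_rw [hT.lintegral_vertexCount_latticeCube, h0, tsum_zero]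
  have hm : Measurable fun ω => vertexCount Set.univ (T ω) :=
    (measurable_vertexCount .univ).comp hT.measurable
  rw [lintegral_eq_zero_iff hm] at h1
  obtain ⟨ω, hω, h⟩ := (h1.and hT.isT3).exists
  obtain ⟨v⟩ := h.1.connected.nonempty
  have : (T ω).verts = ∅ := by simpa [vertexCount] using hω
  exact Set.eq_empty_iff_forall_notMem.1 this v v.2

end IsInvariantRandomT3

theorem proposition3p5 {Ω : Type*} [MeasurableSpace Ω] (P : Measure Ω) [IsProbabilityMeasure P]
    (d : ℕ) (hd : 1 ≤ d) (T : Ω → SpatialGraph d) (hT : IsInvariantRandomT3 P T) :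
    vertexIntensity P T = ∞ := by
  have hle := tsum_le_of_sum_sub_le_card_mul
    (fun k => ∫⁻ ω, SpatialGraph.edgeCount (latticeCube 0 ×ˢ latticeCube k) (T ω) ∂P) _
    hT.sum_lintegral_edgeCount_le
  rw [hT.tsum_lintegral_edgeCount] at hle
  have htop : ∫⁻ ω, SpatialGraph.vertexCount (latticeCube 0) (T ω) ∂P = ∞ := by
    by_contra hne
    -- A nonzero finite `λ` cancels from `3λ ≤ 2λ`, leaving `3 ≤ 2`.
    rw [ENNReal.mul_le_mul_iff_left hT.lintegral_vertexCount_latticeCube_ne_zero hne] at hle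
    norm_num at hle
  refine eq_top_iff.2 (htop ▸ lintegral_mono fun ω => ?_)
  exact ENat.toENNReal_mono (Set.encard_le_encard
    (Set.inter_subset_inter_right _ latticeCube_zero_subset))
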